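/- We work in the $\mathsf{LOCAL}$ model of distributed computing. The nodes of an $n$-vertex graph $G$ carry pairwise distinct identifiers, which are integers between $1$ and $n$. Initially each node knows only its own identifier and $n$. In each synchronous round every node sends a message to each of its neighbors, receives the messages sent by its neighbors, and updates its state; all nodes run the same deterministic algorithm, and there is no bound on the size of messages and states or on the computational power of the nodes. Each node has to choose a color once and for all after finitely many rounds. The algorithm $4$-colors $G$ within $r$ rounds if every node has chosen one of $4$ fixed colors after at most $r$ rounds and the chosen colors form a proper coloring of $G$ (adjacent nodes have distinct colors). **Theorem.** No distributed algorithm can $4$-color every $n$-vertex planar graph in $o(n)$ rounds. That is, there do not exist an algorithm in the $\mathsf{LOCAL}$ model and a function $T:\mathbb{N}\to\mathbb{N}$ with $T(n)=o(n)$ as $n\to\infty$ such that, for every $n$, every planar graph $G$ on $n$ vertices and every assignment of distinct identifiers from $\{1,\dots,n\}$ to the vertices of $G$, the algorithm $4$-colors $G$ within $T(n)$ rounds. -/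

import Mathlib

open Filter Asymptotics

universe u v

/-- `A` is a (simple, closed) arc in the Euclidean plane with ends `x` and `y`: the image of an
injective continuous map from `[0, 1]` that sends `0` to `x` and `1` to `y`. -/
def IsPlaneArc (x y : EuclideanSpace ℝ (Fin 2)) (A : Set (EuclideanSpace ℝ (Fin 2))) : Prop :=
  ∃ γ : Path x y, Function.Injective γ ∧ Set.range γ = A

/-- A graph is planar if it can be drawn in the Euclidean plane: distinct vertices are distinct
points, every edge is an arc between its two ends, no arc passes through a vertex other than the
two ends of the edge, and the arcs of two distinct edges meet only in common ends. -/
def SimpleGraph.IsPlanar {V : Type u} (G : SimpleGraph V) : Prop :=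
  ∃ (p : V → EuclideanSpace ℝ (Fin 2)) (arc : Sym2 V → Set (EuclideanSpace ℝ (Fin 2))),
    Function.Injective p ∧
    (∀ x y : V, G.Adj x y → IsPlaneArc (p x) (p y) (arc s(x, y))) ∧
    (∀ e ∈ G.edgeSet, ∀ w : V, p w ∈ arc e → w ∈ e) ∧
    (∀ e ∈ G.edgeSet, ∀ f ∈ G.edgeSet, e ≠ f → ∀ q ∈ arc e ∩ arc f, ∃ w ∈ e, w ∈ f ∧ p w = q)

/-- A distributed algorithm in the LOCAL model whose nodes output elements of `C`. All nodes run
the same algorithm. There is no bound on the size of states and messages (the types are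
arbitrary), nor on the computational power of the nodes (the functions are arbitrary). -/
structure LocalAlgorithm (C : Type) where
  /-- The possible internal states of a node. -/
  State : Type u
  /-- The possible messages. -/
  Msg : Type v
  /-- `init n i` is the initial state of the node of identifier `i` in an `n`-vertex graph. -/
  init : ℕ → ℕ → State
  /-- `send s j` is the message that a node in state `s` sends in the next round to its neighbor
  of identifier `j`, if it has one. -/
  send : State → ℕ → Msg
  /-- `receive s M` is the next state of a node in state `s` which receives the messages `M` in a
  round: `M` consists of the pairs `(j, m)` such that the neighbor of identifier `j` sent `m`. -/
  receive : State → Set (ℕ × Msg) → State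
  /-- The output chosen by a node in a given state; `none` if it has not chosen yet. -/
  output : State → Option C

/-- The state of the node `x` after `t` synchronous rounds of the algorithm `A` on the `n`-vertex
network `G` whose nodes have the identifiers `ident`. -/
def LocalAlgorithm.state {C : Type} (A : LocalAlgorithm.{u, v} C) {n : ℕ}
    (G : SimpleGraph (Fin n)) (ident : Fin n → ℕ) : ℕ → Fin n → A.State
  | 0, x => A.init n (ident x)
  | t + 1, x => A.receive (A.state G ident t x)
      {q | ∃ y, G.Adj x y ∧ q = (ident y, A.send (A.state G ident t y) (ident x))}

/-- On the network `G` with identifiers `ident`, each node chooses a color after at most `r` rounds,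
and the (first, hence final) choices of the nodes form a proper coloring of `G`. -/
def LocalAlgorithm.ColorsWithin {C : Type} (A : LocalAlgorithm.{u, v} C) {n : ℕ}
    (G : SimpleGraph (Fin n)) (ident : Fin n → ℕ) (r : ℕ) : Prop :=
  ∃ c : G.Coloring C, ∀ x : Fin n, ∃ t ≤ r,
    A.output (A.state G ident t x) = some (c x) ∧
    ∀ s < t, A.output (A.state G ident s x) = none

/-! The hard instance is the cube of a path on `n = 4 * m + 1` nodes. It is planar: adding each
vertex at the centroid of the triangle of its three predecessors draws every edge as a straight
segment (`pathCube_isPlanar`). In the cube of the cycle, four consecutive nodes are pairwise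
adjacent, so a proper 4-coloring would have period 4 around the cycle, impossible as `n` is 1 mod 4.
An `r`-round algorithm cannot tell the two graphs apart at nodes more than about `3 * r` positions
from the path's ends (`LocalAlgorithm.state_pathCube`). Rotating the identifiers brings any five
consecutive cycle nodes into the middle of the path, so correctness on paths makes the outputs on
the nonplanar cycle cube locally proper, a contradiction. -/

/-! ### Separating lines for nested triangles -/

/-- The points of a sequence in the plane that starts with a triangle, each further point being the
centroid of the three preceding ones. -/
noncomputable def centroidSeq : ℕ → EuclideanSpace ℝ (Fin 2)
  | 0 => !₂[0, 0]
  | 1 => !₂[1, 0]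
  | 2 => !₂[0, 1]
  | n + 3 => (1 / 3 : ℝ) • (centroidSeq n + centroidSeq (n + 1) + centroidSeq (n + 2))

lemma map_centroidSeq_add_three (φ : EuclideanSpace ℝ (Fin 2) →ₗ[ℝ] ℝ) (n : ℕ) :
    φ (centroidSeq (n + 3)) =
      (φ (centroidSeq n) + φ (centroidSeq (n + 1)) + φ (centroidSeq (n + 2))) / 3 := by
  rw [centroidSeq]
  simp only [map_smul, map_add, smul_eq_mul]
  ring

/-- Three consecutive points of the sequence are affinely independent: an affine function can be
prescribed on them. -/
lemma exists_affine_centroidSeq (a : ℕ) : ∀ u₀ u₁ u₂ : ℝ,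
    ∃ (φ : EuclideanSpace ℝ (Fin 2) →ₗ[ℝ] ℝ) (c : ℝ), φ (centroidSeq a) = u₀ + c ∧
      φ (centroidSeq (a + 1)) = u₁ + c ∧ φ (centroidSeq (a + 2)) = u₂ + c := by
  induction a with
  | zero =>
    intro u₀ u₁ u₂
    refine ⟨(u₁ - u₀) • (EuclideanSpace.proj (𝕜 := ℝ) (0 : Fin 2)).toLinearMap +
      (u₂ - u₀) • (EuclideanSpace.proj (𝕜 := ℝ) (1 : Fin 2)).toLinearMap, -u₀, ?_, ?_, ?_⟩ <;>
    simp [centroidSeq] <;> ring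
  | succ a ih =>
    intro u₁ u₂ u₃
    -- The first value is obtained by solving the centroid relation for it.
    obtain ⟨φ, c, h₀, h₁, h₂⟩ := ih (3 * u₃ - u₁ - u₂) u₁ u₂
    refine ⟨φ, c, h₁, h₂, ?_⟩
    rw [show a + 1 + 2 = a + 3 by ring, map_centroidSeq_add_three, h₀, h₁, h₂]
    ring

lemma le_map_centroidSeq {φ : EuclideanSpace ℝ (Fin 2) →ₗ[ℝ] ℝ} {c : ℝ} {a : ℕ}
    (h₀ : c ≤ φ (centroidSeq a)) (h₁ : c ≤ φ (centroidSeq (a + 1)))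
    (h₂ : c ≤ φ (centroidSeq (a + 2))) (b : ℕ) : c ≤ φ (centroidSeq (a + b)) := by
  induction b using Nat.strong_induction_on with
  | _ b ih =>
    match b with
    | 0 => exact h₀
    | 1 => exact h₁
    | 2 => exact h₂
    | b + 3 =>
      have i₀ := ih b (by omega)
      have i₁ := ih (b + 1) (by omega)
      have i₂ := ih (b + 2) (by omega)
      rw [← add_assoc] at i₁ i₂ ⊢
      rw [map_centroidSeq_add_three]
      linarith

/-- The convex hull of the points of the sequence from the index `a` on. -/
def centroidTail (a : ℕ) : Set (EuclideanSpace ℝ (Fin 2)) :=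
  convexHull ℝ (centroidSeq '' Set.Ici a)

lemma centroidSeq_mem_centroidTail {a b : ℕ} (h : a ≤ b) : centroidSeq b ∈ centroidTail a :=
  subset_convexHull ℝ _ ⟨b, h, rfl⟩

lemma segment_subset_centroidTail {a b c : ℕ} (hb : a ≤ b) (hc : a ≤ c) :
    segment ℝ (centroidSeq b) (centroidSeq c) ⊆ centroidTail a :=
  (convex_convexHull ℝ _).segment_subset (centroidSeq_mem_centroidTail hb)
    (centroidSeq_mem_centroidTail hc)

lemma le_map_of_mem_centroidTail {φ : EuclideanSpace ℝ (Fin 2) →ₗ[ℝ] ℝ} {c : ℝ} {a : ℕ}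
    (h₀ : c ≤ φ (centroidSeq a)) (h₁ : c ≤ φ (centroidSeq (a + 1)))
    (h₂ : c ≤ φ (centroidSeq (a + 2))) {q : EuclideanSpace ℝ (Fin 2)} (hq : q ∈ centroidTail a) :
    c ≤ φ q := by
  refine convexHull_min (t := {q | c ≤ φ q}) ?_ (convex_halfSpace_ge φ.isLinear c) hq
  rintro _ ⟨b, hb, rfl⟩
  obtain ⟨d, rfl⟩ := Nat.exists_eq_add_of_le (Set.mem_Ici.1 hb)
  exact le_map_centroidSeq h₀ h₁ h₂ d

/-- A line through `centroidSeq (a + i)` separates `centroidSeq a` from all later points. -/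
lemma exists_separating_centroidSeq (a : ℕ) {i : ℕ} (h1 : 1 ≤ i) (h3 : i ≤ 3) :
    ∃ (φ : EuclideanSpace ℝ (Fin 2) →ₗ[ℝ] ℝ) (c : ℝ), φ (centroidSeq a) = c - 1 ∧
      φ (centroidSeq (a + i)) = c ∧ ∀ q ∈ centroidTail (a + 1), c ≤ φ q := by
  -- Relative to `c`, the values are `-1, u, v`; their mean, the value at the centroid, vanishes
  -- because `u + v = 1`.
  have key : ∀ u v : ℝ, 0 ≤ u → 0 ≤ v → u + v = 1 →
      ∃ (φ : EuclideanSpace ℝ (Fin 2) →ₗ[ℝ] ℝ) (c : ℝ), φ (centroidSeq a) = c - 1 ∧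
        φ (centroidSeq (a + 1)) = u + c ∧ φ (centroidSeq (a + 2)) = v + c ∧
        φ (centroidSeq (a + 3)) = c ∧ ∀ q ∈ centroidTail (a + 1), c ≤ φ q := by
    intro u v hu hv huv
    obtain ⟨φ, c, h₀, h₁, h₂⟩ := exists_affine_centroidSeq a (-1) u v
    have h₃ : φ (centroidSeq (a + 3)) = c := by
      rw [map_centroidSeq_add_three, h₀, h₁, h₂]
      linarith
    refine ⟨φ, c, by rw [h₀]; ring, h₁, h₂, h₃, fun q hq => le_map_of_mem_centroidTail ?_ ?_ ?_ hq⟩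
    · rw [h₁]; linarith
    · rw [add_assoc, h₂]; linarith
    · rw [add_assoc, h₃]
  interval_cases i
  · obtain ⟨φ, c, h₀, h₁, -, -, h⟩ := key 0 1 le_rfl zero_le_one (by norm_num)
    exact ⟨φ, c, h₀, by simpa using h₁, h⟩
  · obtain ⟨φ, c, h₀, -, h₂, -, h⟩ := key 1 0 zero_le_one le_rfl (by norm_num)
    exact ⟨φ, c, h₀, by simpa using h₂, h⟩
  · obtain ⟨φ, c, h₀, -, -, h₃, h⟩ := key 1 0 zero_le_one le_rfl (by norm_num)
    exact ⟨φ, c, h₀, h₃, h⟩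

lemma centroidSeq_notMem_centroidTail (a : ℕ) : centroidSeq a ∉ centroidTail (a + 1) := by
  intro h
  obtain ⟨φ, c, h₀, -, hc⟩ := exists_separating_centroidSeq a le_rfl (by norm_num)
  linarith [hc _ h]

lemma centroidSeq_injective : Function.Injective centroidSeq := by
  have hne : ∀ a b, a < b → centroidSeq a ≠ centroidSeq b := fun a b hab h =>
    centroidSeq_notMem_centroidTail a (h ▸ centroidSeq_mem_centroidTail hab)
  intro a b h
  by_contra hab
  rcases lt_or_gt_of_ne hab with hab | hab
  · exact hne a b hab h
  · exact hne b a hab h.symm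

/-- On the segment the separating function is at most `c`, with equality only at the far end, while
it is at least `c` on the tail. Hence edges from `a` do not cross edges among later points. -/
lemma eq_of_mem_segment_of_mem_centroidTail {a i : ℕ} (h1 : 1 ≤ i) (h3 : i ≤ 3)
    {q : EuclideanSpace ℝ (Fin 2)} (hq : q ∈ segment ℝ (centroidSeq a) (centroidSeq (a + i)))
    (hq' : q ∈ centroidTail (a + 1)) : q = centroidSeq (a + i) := by
  obtain ⟨φ, c, h₀, hi, hc⟩ := exists_separating_centroidSeq a h1 h3
  obtain ⟨s, t, hs, -, hst, rfl⟩ := hq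
  have h := hc _ hq'
  simp only [map_add, map_smul, smul_eq_mul, h₀, hi] at h
  obtain rfl : t = 1 - s := by linarith
  obtain rfl : s = 0 := by nlinarith
  simp

/-- This gives non-collinearity, so two edges leaving `a` forward do not overlap. -/
lemma exists_affine_centroidSeq_of_ne (a : ℕ) {i j : ℕ} (hi1 : 1 ≤ i) (hi3 : i ≤ 3) (hj1 : 1 ≤ j)
    (hj3 : j ≤ 3) (hij : i ≠ j) :
    ∃ (φ : EuclideanSpace ℝ (Fin 2) →ₗ[ℝ] ℝ) (c : ℝ), φ (centroidSeq a) = c ∧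
      φ (centroidSeq (a + i)) = 1 + c ∧ φ (centroidSeq (a + j)) = c := by
  have key : ∀ u v : ℝ, ∃ (φ : EuclideanSpace ℝ (Fin 2) →ₗ[ℝ] ℝ) (c : ℝ),
      φ (centroidSeq a) = c ∧ φ (centroidSeq (a + 1)) = u + c ∧ φ (centroidSeq (a + 2)) = v + c ∧
      φ (centroidSeq (a + 3)) = (u + v) / 3 + c := by
    intro u v
    obtain ⟨φ, c, h₀, h₁, h₂⟩ := exists_affine_centroidSeq a 0 u v
    refine ⟨φ, c, by simpa using h₀, h₁, h₂, ?_⟩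
    rw [map_centroidSeq_add_three, h₀, h₁, h₂]
    ring
  have fin : ∀ u v : ℝ, (![0, u, v, (u + v) / 3] : Fin 4 → ℝ) ⟨i, by omega⟩ = 1 →
      (![0, u, v, (u + v) / 3] : Fin 4 → ℝ) ⟨j, by omega⟩ = 0 →
      ∃ (φ : EuclideanSpace ℝ (Fin 2) →ₗ[ℝ] ℝ) (c : ℝ), φ (centroidSeq a) = c ∧
        φ (centroidSeq (a + i)) = 1 + c ∧ φ (centroidSeq (a + j)) = c := by
    intro u v hi hj
    obtain ⟨φ, c, h₀, h₁, h₂, h₃⟩ := key u v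
    have h : ∀ k : Fin 4, φ (centroidSeq (a + k)) =
        (![0, u, v, (u + v) / 3] : Fin 4 → ℝ) k + c := by
      intro k
      fin_cases k <;> simp [h₀, h₁, h₂, h₃]
    exact ⟨φ, c, h₀, by simpa [hi] using h ⟨i, by omega⟩, by simpa [hj] using h ⟨j, by omega⟩⟩
  -- Each pair `u, v` makes the `i`-th entry of `0, u, v, (u + v) / 3` equal to 1 and the `j`-th
  -- equal to 0.
  interval_cases i <;> interval_cases j <;> try exact absurd rfl hij
  · exact fin 1 0 (by simp) (by simp)
  · exact fin 1 (-1) (by simp) (by simp)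
  · exact fin 0 1 (by simp) (by simp)
  · exact fin (-1) 1 (by simp) (by simp)
  · exact fin 0 3 (by simp) (by simp)
  · exact fin 3 0 (by simp) (by simp)

lemma eq_of_mem_segment_of_mem_segment {a i j : ℕ} (hi1 : 1 ≤ i) (hi3 : i ≤ 3) (hj1 : 1 ≤ j)
    (hj3 : j ≤ 3) (hij : i ≠ j) {q : EuclideanSpace ℝ (Fin 2)}
    (hi : q ∈ segment ℝ (centroidSeq a) (centroidSeq (a + i)))
    (hj : q ∈ segment ℝ (centroidSeq a) (centroidSeq (a + j))) : q = centroidSeq a := by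
  obtain ⟨φ, c, h₀, h₁, h₂⟩ := exists_affine_centroidSeq_of_ne a hi1 hi3 hj1 hj3 hij
  obtain ⟨s, t, -, -, hst, rfl⟩ := hi
  obtain ⟨s', t', -, -, hst', h⟩ := hj
  apply_fun φ at h
  simp only [map_add, map_smul, smul_eq_mul, h₀, h₁, h₂] at h
  obtain rfl : s = 1 - t := by linarith
  obtain rfl : s' = 1 - t' := by linarith
  obtain rfl : t = 0 := by linarith
  simp

/-! ### Planarity of the cube of a path -/

lemma isPlaneArc_segment {x y : EuclideanSpace ℝ (Fin 2)} (h : x ≠ y) :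
    IsPlaneArc x y (segment ℝ x y) := by
  refine ⟨⟨⟨fun t => AffineMap.lineMap x y (t : ℝ), by fun_prop⟩, by simp, by simp⟩, ?_, ?_⟩
  · intro s t hst
    exact Subtype.ext (AffineMap.lineMap_injective ℝ h hst)
  · rw [segment_eq_image_lineMap]
    ext q
    constructor
    · rintro ⟨t, rfl⟩
      exact ⟨t, t.2, rfl⟩
    · rintro ⟨t, ht, rfl⟩
      exact ⟨⟨t, ht⟩, rfl⟩

/-- The cube of the path on `n` vertices. -/
def pathCube (n : ℕ) : SimpleGraph (Fin n) where
  Adj x y := x ≠ y ∧ (x : ℕ) ≤ y + 3 ∧ (y : ℕ) ≤ x + 3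
  symm := ⟨fun _ _ h => ⟨h.1.symm, h.2.2, h.2.1⟩⟩
  loopless := ⟨fun _ h => h.1 rfl⟩

lemma exists_of_mem_edgeSet_pathCube {n : ℕ} {e : Sym2 (Fin n)} (he : e ∈ (pathCube n).edgeSet) :
    ∃ x y : Fin n, ∃ i : ℕ, e = s(x, y) ∧ 1 ≤ i ∧ i ≤ 3 ∧ (y : ℕ) = x + i := by
  induction e with
  | _ x y =>
    rw [SimpleGraph.mem_edgeSet] at he
    obtain ⟨hne, h1, h2⟩ := he
    rw [Ne, Fin.ext_iff] at hne
    rcases lt_or_gt_of_ne hne with h | h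
    · exact ⟨x, y, y - x, rfl, by omega, by omega, by omega⟩
    · exact ⟨y, x, x - y, Sym2.eq_swap, by omega, by omega, by omega⟩

lemma centroidSeq_mem_segment {a i w : ℕ} (h1 : 1 ≤ i) (h3 : i ≤ 3)
    (h : centroidSeq w ∈ segment ℝ (centroidSeq a) (centroidSeq (a + i))) : w = a ∨ w = a + i := by
  rcases lt_trichotomy w a with hw | rfl | hw
  -- An earlier point lies outside the hull of all its successors, which contains the segment.
  · exact absurd (segment_subset_centroidTail hw (by omega) h) (centroidSeq_notMem_centroidTail w)
  · exact Or.inl rfl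
  · exact Or.inr (centroidSeq_injective (eq_of_mem_segment_of_mem_centroidTail h1 h3 h
      (centroidSeq_mem_centroidTail hw)))

lemma exists_common_end_centroidSeq {a b i j : ℕ} (hi1 : 1 ≤ i) (hi3 : i ≤ 3) (hj1 : 1 ≤ j)
    (hj3 : j ≤ 3) (hab : a ≤ b) (hne : a ≠ b ∨ i ≠ j) {q : EuclideanSpace ℝ (Fin 2)}
    (hi : q ∈ segment ℝ (centroidSeq a) (centroidSeq (a + i)))
    (hj : q ∈ segment ℝ (centroidSeq b) (centroidSeq (b + j))) :
    (q = centroidSeq a ∧ a = b) ∨ (q = centroidSeq (a + i) ∧ (a + i = b ∨ a + i = b + j)) := by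
  rcases hab.eq_or_lt with rfl | hab
  · exact Or.inl ⟨eq_of_mem_segment_of_mem_segment hi1 hi3 hj1 hj3 (by simpa using hne) hi hj, rfl⟩
  · obtain rfl := eq_of_mem_segment_of_mem_centroidTail hi1 hi3 hi
      (segment_subset_centroidTail hab (by omega) hj)
    exact Or.inr ⟨rfl, centroidSeq_mem_segment hj1 hj3 hj⟩

theorem pathCube_isPlanar (n : ℕ) : (pathCube n).IsPlanar := by
  obtain ⟨arc, harc⟩ : ∃ arc : Sym2 (Fin n) → Set (EuclideanSpace ℝ (Fin 2)),
      ∀ x y, arc s(x, y) = segment ℝ (centroidSeq x) (centroidSeq y) :=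
    ⟨Sym2.lift ⟨fun x y => segment ℝ (centroidSeq x) (centroidSeq y),
      fun x y => segment_symm ℝ _ _⟩, fun x y => rfl⟩
  have hinj : Function.Injective fun x : Fin n => centroidSeq x :=
    centroidSeq_injective.comp Fin.val_injective
  refine ⟨fun x => centroidSeq x, arc, hinj, ?_, ?_, ?_⟩
  · intro x y h
    rw [harc]
    exact isPlaneArc_segment (hinj.ne h.1)
  · intro e he w hw
    obtain ⟨x, y, i, rfl, h1, h3, hy⟩ := exists_of_mem_edgeSet_pathCube he
    rw [harc, hy] at hw
    rw [Sym2.mem_iff, Fin.ext_iff, Fin.ext_iff, hy]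
    exact centroidSeq_mem_segment h1 h3 hw
  · have main : ∀ (x y z w : Fin n) (i j : ℕ), 1 ≤ i → i ≤ 3 → 1 ≤ j → j ≤ 3 → (y : ℕ) = x + i →
        (w : ℕ) = z + j → (x : ℕ) ≤ z → s(x, y) ≠ s(z, w) →
        ∀ q ∈ segment ℝ (centroidSeq x) (centroidSeq y),
          q ∈ segment ℝ (centroidSeq z) (centroidSeq w) →
          ∃ v : Fin n, v ∈ s(x, y) ∧ v ∈ s(z, w) ∧ centroidSeq v = q := by
      intro x y z w i j hi1 hi3 hj1 hj3 hy hw hxz hne q hq hq'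
      rw [hy] at hq
      rw [hw] at hq'
      have hne' : (x : ℕ) ≠ z ∨ i ≠ j := by
        by_contra! h
        refine hne ?_
        rw [Fin.ext h.1, show y = w from Fin.ext (by omega)]
      rcases exists_common_end_centroidSeq hi1 hi3 hj1 hj3 hxz hne' hq hq' with ⟨rfl, h⟩ | ⟨rfl, h⟩
      · exact ⟨x, Sym2.mem_mk_left _ _, by simp [Fin.ext h], rfl⟩
      · refine ⟨y, Sym2.mem_mk_right _ _, ?_, by rw [hy]⟩
        rw [Sym2.mem_iff, Fin.ext_iff, Fin.ext_iff]
        omega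
    rintro e he f hf hef q ⟨hqe, hqf⟩
    obtain ⟨x, y, i, rfl, hi1, hi3, hy⟩ := exists_of_mem_edgeSet_pathCube he
    obtain ⟨z, w, j, rfl, hj1, hj3, hw⟩ := exists_of_mem_edgeSet_pathCube hf
    rw [harc] at hqe hqf
    rcases le_total (x : ℕ) z with h | h
    · exact main x y z w i j hi1 hi3 hj1 hj3 hy hw h hef q hqe hqf
    · obtain ⟨v, hv, hv', h⟩ := main z w x y j i hj1 hj3 hi1 hi3 hw hy h hef.symm q hqf hqe
      exact ⟨v, hv', hv, h⟩

/-! ### Indistinguishability of path and cycle -/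

/-- The cube of the cycle on `n` vertices. -/
def cycleCube (n : ℕ) : SimpleGraph (Fin n) where
  Adj x y := x ≠ y ∧ (((x : ℕ) ≤ y + 3 ∧ (y : ℕ) ≤ x + 3) ∨ n ≤ x + 3 - y ∨ n ≤ y + 3 - x)
  symm := ⟨fun _ _ h => ⟨h.1.symm, h.2.elim (fun h => Or.inl h.symm) fun h => Or.inr h.symm⟩⟩
  loopless := ⟨fun _ h => h.1 rfl⟩

lemma cycleCube_adj_add_right {n : ℕ} (x y c : Fin n) :
    (cycleCube n).Adj (x + c) (y + c) ↔ (cycleCube n).Adj x y := by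
  simp only [cycleCube, Ne, Fin.ext_iff, Fin.val_add_eq_ite]
  have := x.2
  have := y.2
  have := c.2
  split_ifs <;> omega

lemma cycleCube_adj_iff_pathCube_adj {n : ℕ} {x y : Fin n} (h3 : 3 ≤ (x : ℕ))
    (hn : (x : ℕ) + 3 < n) : (cycleCube n).Adj x y ↔ (pathCube n).Adj x y := by
  simp only [cycleCube, pathCube, Ne, Fin.ext_iff]
  have := y.2
  omega

/-- A node of the cube of a path does not notice within `t` rounds that it is not in the cube of a
cycle, if it is far enough from the ends of the path. -/
lemma LocalAlgorithm.state_pathCube {C : Type} (A : LocalAlgorithm.{u, v} C) {n : ℕ}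
    (ident : Fin n → ℕ) (c : Fin n) (t : ℕ) : ∀ x : Fin n, 3 * t ≤ x → x + 3 * t < n →
      A.state (pathCube n) (fun y => ident (y + c)) t x =
        A.state (cycleCube n) ident t (x + c) := by
  induction t with
  | zero => intro x _ _; rfl
  | succ t ih =>
    intro x hx hxn
    have : NeZero n := ⟨by omega⟩
    simp only [LocalAlgorithm.state]
    rw [ih x (by omega) (by omega)]
    congr 1
    ext q
    -- Neighbors are at most 3 positions away, so each round costs a margin of 3 on either side.
    have step : ∀ y, (pathCube n).Adj x y →
        A.state (pathCube n) (fun y => ident (y + c)) t y =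
          A.state (cycleCube n) ident t (y + c) := by
      rintro y ⟨-, h1, h2⟩
      exact ih y (by omega) (by omega)
    constructor
    · rintro ⟨y, hy, rfl⟩
      refine ⟨y + c, ?_, by rw [step y hy]⟩
      rwa [cycleCube_adj_add_right, cycleCube_adj_iff_pathCube_adj (by omega) (by omega)]
    · rintro ⟨z, hz, rfl⟩
      obtain ⟨y, rfl⟩ : ∃ y, z = y + c := ⟨z - c, by simp⟩
      rw [cycleCube_adj_add_right, cycleCube_adj_iff_pathCube_adj (by omega) (by omega)] at hz
      exact ⟨y, hz, by rw [step y hz]⟩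

/-- The first output of the node `x` on the network `G` with identifiers `ident` is `k`. -/
def LocalAlgorithm.Chooses {C : Type} (A : LocalAlgorithm.{u, v} C) {n : ℕ}
    (G : SimpleGraph (Fin n)) (ident : Fin n → ℕ) (x : Fin n) (k : C) : Prop :=
  ∃ t, A.output (A.state G ident t x) = some k ∧ ∀ s < t, A.output (A.state G ident s x) = none

lemma LocalAlgorithm.Chooses.unique {C : Type} {A : LocalAlgorithm.{u, v} C} {n : ℕ}
    {G : SimpleGraph (Fin n)} {ident : Fin n → ℕ} {x : Fin n} {k l : C}
    (hk : A.Chooses G ident x k) (hl : A.Chooses G ident x l) : k = l := by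
  obtain ⟨s, hs, hs'⟩ := hk
  obtain ⟨t, ht, ht'⟩ := hl
  rcases lt_trichotomy s t with h | rfl | h
  · simp [ht' s h] at hs
  · exact Option.some_injective _ (hs.symm.trans ht)
  · simp [hs' t h] at ht

lemma ofNat_add_ofNat {n : ℕ} [NeZero n] (i j : ℕ) :
    Fin.ofNat n i + Fin.ofNat n j = Fin.ofNat n (i + j) := by
  apply Fin.ext
  simp [Fin.val_add]

/-- If the algorithm colors the cube of a path within `r` rounds, whatever the cyclic shift of the
identifiers, then its choices on the cube of the cycle are locally proper. -/
lemma LocalAlgorithm.exists_color_cycleCube {C : Type} (A : LocalAlgorithm.{u, v} C) {n r : ℕ}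
    [NeZero n] (ident : Fin n → ℕ) (hr : 6 * r + 4 < n)
    (hA : ∀ c : Fin n, A.ColorsWithin (pathCube n) (fun y => ident (y + c)) r) (x : Fin n) :
    ∃ k : ℕ → C, (∀ i ≤ 4, A.Chooses (cycleCube n) ident (x + Fin.ofNat n i) (k i)) ∧
      ∀ i ≤ 4, ∀ j ≤ 4, i < j → j ≤ i + 3 → k i ≠ k j := by
  -- This shift puts the window `x, …, x + 4` at path positions `3 * r, …, 3 * r + 4`; the margin of
  -- `3 * r` on the right is `hr`.
  obtain ⟨col, hcol⟩ := hA (x - Fin.ofNat n (3 * r))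
  have hval : ∀ i ≤ 4, ((Fin.ofNat n (3 * r + i) : Fin n) : ℕ) = 3 * r + i := fun i hi =>
    Nat.mod_eq_of_lt (by omega)
  refine ⟨fun i => col (Fin.ofNat n (3 * r + i)), fun i hi => ?_, fun i hi j hj hij hj3 => ?_⟩
  · obtain ⟨t, ht, hout, hnone⟩ := hcol (Fin.ofNat n (3 * r + i))
    have hx : Fin.ofNat n (3 * r + i) + (x - Fin.ofNat n (3 * r)) = x + Fin.ofNat n i := by
      rw [← ofNat_add_ofNat]
      abel
    have hstate : ∀ s ≤ r, A.state (pathCube n) _ s (Fin.ofNat n (3 * r + i)) = _ := fun s hs =>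
      A.state_pathCube ident (x - Fin.ofNat n (3 * r)) s _
        (by rw [hval i hi]; omega) (by rw [hval i hi]; omega)
    rw [← hx]
    refine ⟨t, by rw [← hstate t ht, hout], fun s hs => ?_⟩
    rw [← hstate s (by omega), hnone s hs]
  · refine col.valid ⟨?_, ?_, ?_⟩
    · rw [Ne, Fin.ext_iff, hval i hi, hval j hj]; omega
    · rw [hval i hi, hval j hj]; omega
    · rw [hval i hi, hval j hj]; omega

/-! ### The coloring contradiction -/

theorem LocalAlgorithm.not_colorsWithin_pathCube (A : LocalAlgorithm.{u, v} (Fin 4)) {n r m : ℕ}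
    (hn : n = 4 * m + 1) (ident : Fin n → ℕ) (hr : 6 * r + 4 < n) :
    ¬ ∀ c : Fin n, A.ColorsWithin (pathCube n) (fun y => ident (y + c)) r := by
  intro hA
  have : NeZero n := ⟨by omega⟩
  have hloc := A.exists_color_cycleCube ident hr hA
  have hex : ∀ x, ∃ k, A.Chooses (cycleCube n) ident x k := fun x => by
    obtain ⟨k, hk, -⟩ := hloc x
    exact ⟨k 0, by simpa using hk 0 (by norm_num)⟩
  choose f hf using hex
  have hproper : ∀ x : Fin n, ∀ i ≤ 4, ∀ j ≤ 4, i < j → j ≤ i + 3 →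
      f (x + Fin.ofNat n i) ≠ f (x + Fin.ofNat n j) := by
    intro x i hi j hj hij hj3
    obtain ⟨k, hk, hne⟩ := hloc x
    rw [(hf _).unique (hk i hi), (hf _).unique (hk j hj)]
    exact hne i hi j hj hij hj3
  have hperiod : ∀ x : Fin n, f (x + Fin.ofNat n 4) = f x := by
    intro x
    -- The three middle nodes use three colors, leaving a single one for both outer nodes.
    have pigeonhole : ∀ a b c d e : Fin 4, a ≠ b → a ≠ c → a ≠ d → b ≠ c → b ≠ d → c ≠ d → b ≠ e →
        c ≠ e → d ≠ e → e = a := by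
      intro a b c d e
      omega
    have h := hproper x
    have h0 : x + Fin.ofNat n 0 = x := by simp
    refine pigeonhole _ (f (x + Fin.ofNat n 1)) (f (x + Fin.ofNat n 2))
      (f (x + Fin.ofNat n 3)) _ ?_ ?_ ?_ (h 1 ?_ 2 ?_ ?_ ?_) (h 1 ?_ 3 ?_ ?_ ?_)
      (h 2 ?_ 3 ?_ ?_ ?_) (h 1 ?_ 4 ?_ ?_ ?_) (h 2 ?_ 4 ?_ ?_ ?_) (h 3 ?_ 4 ?_ ?_ ?_)
    · simpa only [h0] using h 0 (by norm_num) 1 (by norm_num) (by norm_num) (by norm_num)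
    · simpa only [h0] using h 0 (by norm_num) 2 (by norm_num) (by norm_num) (by norm_num)
    · simpa only [h0] using h 0 (by norm_num) 3 (by norm_num) (by norm_num) (by norm_num)
    all_goals norm_num
  have hmul : ∀ j : ℕ, ∀ x : Fin n, f (x + Fin.ofNat n (4 * j)) = f x := by
    intro j
    induction j with
    | zero => intro x; simp
    | succ j ih =>
      intro x
      rw [mul_add, mul_one, ← ofNat_add_ofNat, ← add_assoc, hperiod, ih]
  refine hproper 0 0 (by norm_num) 1 (by norm_num) (by norm_num) (by norm_num) ?_
  -- Going `4 * m` positions on from node 1 returns to node 0, so these adjacent nodes share a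
  -- color.
  rw [← hmul m (0 + Fin.ofNat n 1), add_assoc, ofNat_add_ofNat]
  congr 2
  apply Fin.ext
  simp [hn, add_comm]

theorem theorem1p5 :
    ¬ ∃ (A : LocalAlgorithm.{u, v} (Fin 4)) (T : ℕ → ℕ),
      ((fun n : ℕ => (T n : ℝ)) =o[atTop] fun n : ℕ => (n : ℝ)) ∧
      ∀ (n : ℕ) (G : SimpleGraph (Fin n)), G.IsPlanar →
        ∀ ident : Fin n → ℕ, Function.Injective ident → (∀ x, ident x ∈ Set.Icc 1 n) →
          A.ColorsWithin G ident (T n) := by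
  rintro ⟨A, T, hT, hA⟩
  obtain ⟨N, hN⟩ := eventually_atTop.1 (hT.bound (show (0 : ℝ) < 1 / 12 by norm_num))
  -- With `12 * T n ≤ n`, the bound `9 ≤ n` yields `6 * T n + 4 < n`.
  obtain ⟨n, m, hn, hNn, h9⟩ : ∃ n m, n = 4 * m + 1 ∧ N ≤ n ∧ 9 ≤ n :=
    ⟨4 * (N + 2) + 1, N + 2, rfl, by omega, by omega⟩
  have hb := hN n hNn
  rw [Real.norm_natCast, Real.norm_natCast] at hb
  have hb' : 12 * T n ≤ n := by
    have : (12 * T n : ℝ) ≤ n := by linarith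
    exact_mod_cast this
  have : NeZero n := ⟨by omega⟩
  refine A.not_colorsWithin_pathCube hn (fun x => x + 1) (r := T n) (by omega) fun c => ?_
  refine hA n _ (pathCube_isPlanar n) _ (fun x y h => ?_) fun x => ⟨by simp, (x + c).2⟩
  exact add_right_cancel (Fin.ext (Nat.succ_injective h))
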